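/- A permutation of $[n]=\{1,\dots,n\}$ is written as the sequence $(\pi(1),\dots,\pi(n))$. The shape of a sequence $(x_1,\dots,x_w)$ of distinct numbers is the sequence $(s_1,\dots,s_{w-1})\in\{+,-\}^{w-1}$ with $s_i=+$ if and only if $x_i<x_{i+1}$. Weak twins of length $w$ in $\pi$ are two sub-permutations $(\pi(i_1),\dots,\pi(i_w))$, $i_1<\dots<i_w$, and $(\pi(j_1),\dots,\pi(j_w))$, $j_1<\dots<j_w$, with $\{i_1,\dots,i_w\}\cap\{j_1,\dots,j_w\}=\emptyset$ and with the same shape; they are alternating twins if this common shape is $(+,-,+,\dots)$ or $(-,+,-,\dots)$. Let $\alpha(\pi)$ be the largest $w$ such that $\pi$ contains alternating twins of length $w$, and let $\alpha_n=\alpha(\Pi_n)$, where $\Pi_n$ is chosen uniformly at random from all $n!$ permutations of $[n]$. Theorem. Asymptotically almost surely, $$\left(\frac13+\frac1{60}+o(1)\right)n\le\alpha_n\le\left(\frac12-\frac1{120}+o(1)\right)n,$$ that is, there are deterministic sequences $\varepsilon_n\to0$ and $\delta_n\to0$ such that $$\lim_{n\to\infty}\mathbb P\left(\left(\frac13+\frac1{60}+\varepsilon_n\right)n\le\alpha_n\le\left(\frac12-\frac1{120}+\delta_n\right)n\right)=1.$$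 -/

import Mathlib

namespace Twins

/-- The shape of a sequence `x₁, …, x_w` with distinct entries: entry `k` is `true` (a `+`) if the
`k`-th entry is smaller than the next one and `false` (a `-`) otherwise (indices start at `0`). -/
def shape {n w : ℕ} (x : Fin w → Fin n) : Fin (w - 1) → Bool :=
  fun k => decide (x ⟨k, by omega⟩ < x ⟨k + 1, by omega⟩)

/-- The alternating shape `(+, -, +, …)` of a sequence of length `w`. -/
def altPlus (w : ℕ) : Fin (w - 1) → Bool := fun k => decide (Even (k : ℕ))

/-- The alternating shape `(-, +, -, …)` of a sequence of length `w`. -/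
def altMinus (w : ℕ) : Fin (w - 1) → Bool := fun k => decide (Odd (k : ℕ))

/-- The sub-permutations of `π` at the increasing position sequences `i` and `j` are weak twins:
they are disjoint and have the same shape. -/
def IsWeakTwins {n w : ℕ} (π : Equiv.Perm (Fin n)) (i j : Fin w ↪o Fin n) : Prop :=
  Disjoint (Set.range i) (Set.range j) ∧ shape (π ∘ i) = shape (π ∘ j)

/-- `π` contains alternating twins of length `w`. -/
def HasAlternatingTwins {n : ℕ} (π : Equiv.Perm (Fin n)) (w : ℕ) : Prop :=
  ∃ i j : Fin w ↪o Fin n, IsWeakTwins π i j ∧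
    (shape (π ∘ i) = altPlus w ∨ shape (π ∘ i) = altMinus w)

/-- The largest length of alternating twins in `π`. -/
noncomputable def alpha {n : ℕ} (π : Equiv.Perm (Fin n)) : ℕ :=
  sSup {w | HasAlternatingTwins π w}

/-- The supremum in the definition of `alpha` is a maximum. -/
theorem isGreatest_alpha {n : ℕ} (π : Equiv.Perm (Fin n)) :
    IsGreatest {w | HasAlternatingTwins π w} (alpha π) := by
  have hb : BddAbove {w | HasAlternatingTwins π w} := by
    refine ⟨n, ?_⟩
    rintro w ⟨i, -, -⟩
    simpa using Fintype.card_le_of_injective i i.injective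
  have hne : {w | HasAlternatingTwins π w}.Nonempty := by
    refine ⟨0, OrderEmbedding.ofIsEmpty, OrderEmbedding.ofIsEmpty, ⟨?_, rfl⟩, Or.inl ?_⟩
    · simp
    · funext k
      exact k.elim0
  exact ⟨Nat.sSup_mem hne hb, fun w hw => le_csSup hb hw⟩

end Twins

/-! Both bounds come from counting windows of consecutive positions with a prescribed order pattern.
Rearranging one window uniformly leaves every disjoint window untouched, so centered indicators of
disjoint windows are uncorrelated. The variance of a count is therefore O(n), and Chebyshev's
inequality keeps the count close to the density of the pattern times the number of windows
(`card_patternCount_lt_le`).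

Upper bound: an alternating sequence takes at most two terms from a monotone run, so twins miss at
least L - 4 of its L positions. For L ≥ 4 this is the number of monotone five-windows in the run.
Neighbouring runs share an endpoint, but the losses still add up (`monotoneCount_le_misses`). Hence
2w plus the number of monotone five-windows is at most n, and their density is 2/5! = 1/60.

Lower bound: cut the positions into two halves. One twin is chosen among the local extrema on the
left and the non-extrema on the right, the other among the complementary interior positions. Extrema
have density 2/3, and restricting to them keeps all but two per half as turns. The non-extrema still
produce turns of their own; those certified by `InteriorTurnPattern` have density 24/6! = 1/30. Each
class thus has about (n/2)(2/3 + 1/30) = (1/3 + 1/60)n turns, and T turns yield an alternating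
subsequence of length T (`exists_alternating_of_turns`). Exchanging the roles of the halves is what
balances the twins. -/

namespace Twins

/-! ### Second moment of pattern counts in a random permutation -/

/-- The value of `π` at position `i`, as a natural number (`0` outside the range of positions). -/
def value {n : ℕ} (π : Equiv.Perm (Fin n)) (i : ℕ) : ℕ := if h : i < n then π ⟨i, h⟩ else 0

theorem value_of_lt {n : ℕ} (π : Equiv.Perm (Fin n)) {i : ℕ} (h : i < n) :
    value π i = π ⟨i, h⟩ := dif_pos h

theorem value_injOn {n : ℕ} (π : Equiv.Perm (Fin n)) : Set.InjOn (value π) (Set.Iio n) := by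
  intro i hi j hj h
  rw [value_of_lt π hi, value_of_lt π hj] at h
  exact congrArg Fin.val (π.injective (Fin.ext h))

/-- `Q` depends only on the relative order of the entries of the sequence. -/
def OrderInvariant {k : ℕ} (Q : (Fin k → ℕ) → Prop) : Prop :=
  ∀ x y : Fin k → ℕ, (∀ i j, x i < x j ↔ y i < y j) → (Q x ↔ Q y)

open Classical in
/-- The proportion of the permutations of `Fin k` that satisfy `Q`. -/
noncomputable def patternDensity {k : ℕ} (Q : (Fin k → ℕ) → Prop) : ℝ :=
  (Finset.univ.filter fun σ : Equiv.Perm (Fin k) => Q fun i => σ i).card / (k.factorial : ℝ)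

open Classical in
-- After sorting, `x ∘ σ` has the same relative order as `(Tuple.sort x)⁻¹ * σ`, and left
-- multiplication by a fixed permutation is a bijection.
theorem card_filter_comp_perm {k : ℕ} {Q : (Fin k → ℕ) → Prop} (hQ : OrderInvariant Q)
    {x : Fin k → ℕ} (hx : Function.Injective x) :
    (Finset.univ.filter fun σ : Equiv.Perm (Fin k) => Q fun i => x (σ i)).card =
      (Finset.univ.filter fun σ : Equiv.Perm (Fin k) => Q fun i => σ i).card := by
  have hs : StrictMono (x ∘ Tuple.sort x) :=
    (Tuple.monotone_sort x).strictMono_of_injective (hx.comp (Tuple.sort x).injective)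
  refine Finset.card_equiv (Equiv.mulLeft (Tuple.sort x)⁻¹) fun σ => ?_
  simp only [Finset.mem_filter, Finset.mem_univ, true_and]
  refine hQ _ _ fun i j => ?_
  have := hs.lt_iff_lt (a := (Tuple.sort x)⁻¹ (σ i)) (b := (Tuple.sort x)⁻¹ (σ j))
  simpa using this

/-- The positions `i, …, i + k - 1` of a window. -/
def windowEmb {n : ℕ} (k i : ℕ) (h : i + k ≤ n) : Fin k ↪ Fin n where
  toFun j := ⟨i + j, by omega⟩
  inj' a b hab := by
    ext
    simpa using hab

theorem windowEmb_apply {n k i : ℕ} (h : i + k ≤ n) (j : Fin k) :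
    windowEmb k i h j = ⟨i + j, by omega⟩ := rfl

open Classical in
/-- The centered indicator of the event that the window of `π` at `i` satisfies `Q`. -/
noncomputable def centered {n k : ℕ} (Q : (Fin k → ℕ) → Prop) (i : ℕ) (π : Equiv.Perm (Fin n)) :
    ℝ :=
  (if Q (fun j => value π (i + j)) then 1 else 0) - patternDensity Q

theorem value_mul_viaEmbedding {n k i : ℕ} (h : i + k ≤ n) (π : Equiv.Perm (Fin n))
    (σ : Equiv.Perm (Fin k)) (j : Fin k) :
    value (π * σ.viaEmbedding (windowEmb k i h)) (i + j) = value π (i + (σ j : ℕ)) := by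
  rw [value_of_lt _ (by omega), value_of_lt _ (by omega)]
  have := σ.viaEmbedding_apply (windowEmb k i h) j
  rw [windowEmb_apply, windowEmb_apply] at this
  rw [Equiv.Perm.mul_apply, this]

theorem value_mul_viaEmbedding_of_notMem {n k i : ℕ} (h : i + k ≤ n) (π : Equiv.Perm (Fin n))
    (σ : Equiv.Perm (Fin k)) {m : ℕ} (hm : m < i ∨ i + k ≤ m) :
    value (π * σ.viaEmbedding (windowEmb k i h)) m = value π m := by
  by_cases hn : m < n
  · rw [value_of_lt _ hn, value_of_lt _ hn, Equiv.Perm.mul_apply,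
      Equiv.Perm.viaEmbedding_apply_of_notMem]
    rintro ⟨j, hj⟩
    have := congrArg Fin.val hj
    rw [windowEmb_apply] at this
    dsimp only at this
    omega
  · simp [value, hn]

theorem sum_centered_viaEmbedding {n k i : ℕ} {Q : (Fin k → ℕ) → Prop} (hQ : OrderInvariant Q)
    (h : i + k ≤ n) (π : Equiv.Perm (Fin n)) :
    ∑ σ : Equiv.Perm (Fin k), centered Q i (π * σ.viaEmbedding (windowEmb k i h)) = 0 := by
  classical
  have hinj : Function.Injective fun j : Fin k => value π (i + j) := by
    intro a b hab
    have := value_injOn π (show i + (a : ℕ) < n by omega) (show i + (b : ℕ) < n by omega) hab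
    ext
    omega
  have hk : (k.factorial : ℝ) ≠ 0 := by positivity
  simp only [centered, value_mul_viaEmbedding, Finset.sum_sub_distrib, Finset.sum_const,
    Finset.card_univ, Fintype.card_perm, Fintype.card_fin, nsmul_eq_mul, patternDensity]
  rw [Finset.sum_boole, mul_div_cancel₀ _ hk, sub_eq_zero]
  exact_mod_cast card_filter_comp_perm hQ hinj

/-- Right multiplication by a rearrangement of the window permutes the summation range. Averaging
over all rearrangements annihilates the centered indicator while `Y` factors out. -/
theorem sum_centered_mul_of_invariant {n k i : ℕ} {Q : (Fin k → ℕ) → Prop}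
    (hQ : OrderInvariant Q) (h : i + k ≤ n) (Y : Equiv.Perm (Fin n) → ℝ)
    (hY : ∀ (π : Equiv.Perm (Fin n)) (σ : Equiv.Perm (Fin k)),
      Y (π * σ.viaEmbedding (windowEmb k i h)) = Y π) :
    ∑ π : Equiv.Perm (Fin n), centered Q i π * Y π = 0 := by
  have key (σ : Equiv.Perm (Fin k)) : ∑ π : Equiv.Perm (Fin n), centered Q i π * Y π =
      ∑ π : Equiv.Perm (Fin n), centered Q i (π * σ.viaEmbedding (windowEmb k i h)) * Y π := by
    rw [← Equiv.sum_comp (Equiv.mulRight (σ.viaEmbedding (windowEmb k i h)))]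
    simp [hY]
  have hsum : ∑ _σ : Equiv.Perm (Fin k), ∑ π : Equiv.Perm (Fin n), centered Q i π * Y π = 0 := by
    rw [Finset.sum_congr rfl fun σ _ => key σ, Finset.sum_comm]
    refine Finset.sum_eq_zero fun π _ => ?_
    rw [← Finset.sum_mul, sum_centered_viaEmbedding hQ h, zero_mul]
  simpa [Fintype.card_perm, Nat.factorial_ne_zero] using hsum

theorem sum_centered_mul_centered {n k i j : ℕ} {Q : (Fin k → ℕ) → Prop}
    (hQ : OrderInvariant Q) (h : i + k ≤ n) (hij : j + k ≤ i ∨ i + k ≤ j) :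
    ∑ π : Equiv.Perm (Fin n), centered Q i π * centered Q j π = 0 := by
  refine sum_centered_mul_of_invariant hQ h _ fun π σ => ?_
  have : (fun l : Fin k => value (π * σ.viaEmbedding (windowEmb k i h)) (j + l)) =
      fun l : Fin k => value π (j + l) :=
    funext fun l => value_mul_viaEmbedding_of_notMem h π σ (by omega)
  rw [centered, centered, this]

theorem patternDensity_mem_Icc {k : ℕ} (Q : (Fin k → ℕ) → Prop) :
    patternDensity Q ∈ Set.Icc (0 : ℝ) 1 := by
  classical
  refine ⟨by unfold patternDensity; positivity, ?_⟩
  rw [patternDensity, div_le_one (by positivity)]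
  have := Finset.card_filter_le (Finset.univ : Finset (Equiv.Perm (Fin k)))
    fun σ => Q fun i => σ i
  rw [Finset.card_univ, Fintype.card_perm, Fintype.card_fin] at this
  exact_mod_cast this

theorem abs_centered_le_one {n k : ℕ} (Q : (Fin k → ℕ) → Prop) (i : ℕ) (π : Equiv.Perm (Fin n)) :
    |centered Q i π| ≤ 1 := by
  obtain ⟨h0, h1⟩ := patternDensity_mem_Icc Q
  rw [abs_le, centered]
  split_ifs <;> constructor <;> linarith

theorem sum_sq_sum_centered_le {n k : ℕ} {Q : (Fin k → ℕ) → Prop} (hQ : OrderInvariant Q)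
    (I : Finset ℕ) (hI : ∀ i ∈ I, i + k ≤ n) :
    ∑ π : Equiv.Perm (Fin n), (∑ i ∈ I, centered Q i π) ^ 2 ≤ I.card * (2 * k) * n.factorial := by
  have h1 : ∑ π : Equiv.Perm (Fin n), (∑ i ∈ I, centered Q i π) ^ 2 =
      ∑ i ∈ I, ∑ j ∈ I, ∑ π : Equiv.Perm (Fin n), centered Q i π * centered Q j π := by
    simp_rw [sq, Finset.sum_mul_sum]
    rw [Finset.sum_comm]
    exact Finset.sum_congr rfl fun i _ => Finset.sum_comm
  rw [h1, mul_assoc, ← nsmul_eq_mul]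
  refine Finset.sum_le_card_nsmul _ _ _ fun i hi => ?_
  -- Disjoint windows contribute nothing; at most `2 * k` windows can meet the one at `i`, and each
  -- product is at most 1.
  have h2 : ∑ j ∈ I, ∑ π : Equiv.Perm (Fin n), centered Q i π * centered Q j π ≤
      ∑ j ∈ I, if j ∈ Finset.Ico (i - k) (i + k) then (n.factorial : ℝ) else 0 := by
    refine Finset.sum_le_sum fun j _ => ?_
    split_ifs with hj
    · calc ∑ π : Equiv.Perm (Fin n), centered Q i π * centered Q j π
          ≤ ∑ _π : Equiv.Perm (Fin n), (1 : ℝ) := by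
            refine Finset.sum_le_sum fun π _ => (le_abs_self _).trans ?_
            rw [abs_mul]
            exact mul_le_one₀ (abs_centered_le_one Q i π) (abs_nonneg _)
              (abs_centered_le_one Q j π)
        _ = n.factorial := by simp [Fintype.card_perm]
    · rw [Finset.mem_Ico] at hj
      exact (sum_centered_mul_centered hQ (hI i hi) (by omega)).le
  refine h2.trans ?_
  rw [← Finset.sum_filter, Finset.sum_const, nsmul_eq_mul]
  refine mul_le_mul_of_nonneg_right ?_ (by positivity)
  have h3 : (I.filter fun j => j ∈ Finset.Ico (i - k) (i + k)).card ≤ 2 * k := by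
    refine (Finset.card_le_card (t := Finset.Ico (i - k) (i + k)) fun j hj =>
      (Finset.mem_filter.1 hj).2).trans ?_
    rw [Nat.card_Ico]
    omega
  exact_mod_cast h3

open Classical in
/-- The number of window positions in `I` at which `π` satisfies `Q`. -/
noncomputable def patternCount {n k : ℕ} (Q : (Fin k → ℕ) → Prop) (I : Finset ℕ)
    (π : Equiv.Perm (Fin n)) : ℕ :=
  (I.filter fun i => Q fun j => value π (i + j)).card

open Classical in
/-- Chebyshev's inequality for the number of windows satisfying `Q`. -/
theorem card_patternCount_lt_le {n k : ℕ} {Q : (Fin k → ℕ) → Prop} (hQ : OrderInvariant Q)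
    (I : Finset ℕ) (hI : ∀ i ∈ I, i + k ≤ n) {η : ℝ} (hη : 0 ≤ η) :
    ((Finset.univ.filter fun π : Equiv.Perm (Fin n) =>
      (patternCount Q I π : ℝ) < patternDensity Q * I.card - η).card : ℝ) * η ^ 2 ≤
        I.card * (2 * k) * n.factorial := by
  refine le_trans ?_ (sum_sq_sum_centered_le hQ I hI)
  rw [← nsmul_eq_mul]
  refine (Finset.card_nsmul_le_sum _ (fun π => (∑ i ∈ I, centered Q i π) ^ 2) _ ?_).trans
    (Finset.sum_le_sum_of_subset_of_nonneg (Finset.subset_univ _) fun _ _ _ => sq_nonneg _)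
  intro π hπ
  have h := (Finset.mem_filter.1 hπ).2
  have hc : ∑ i ∈ I, centered Q i π = patternCount Q I π - patternDensity Q * I.card := by
    simp only [centered, Finset.sum_sub_distrib, Finset.sum_boole, patternCount, Finset.sum_const,
      nsmul_eq_mul]
    ring
  rw [hc]
  nlinarith

/-! ### Monotone runs and alternating subsequences -/

/-- All steps of `g` between the positions `r` and `t` go up (if `d` holds) or fail to do so. -/
def IsRun (g : ℕ → ℕ) (r t : ℕ) (d : Prop) : Prop :=
  ∀ i, r ≤ i → i < t → (g i < g (i + 1) ↔ d)

theorem IsRun.lt_iff {g : ℕ → ℕ} {n r t : ℕ} {d : Prop} (hg : Set.InjOn g (Set.Iio n))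
    (h : IsRun g r t d) (ht : t < n) {i j : ℕ} (hi : r ≤ i) (hij : i < j) (hj : j ≤ t) :
    g i < g j ↔ d := by
  have hne {m : ℕ} (hm : m + 1 < n) : g m ≠ g (m + 1) := fun he => by
    have := hg (show m < n by omega) (show m + 1 < n from hm) he
    omega
  have key : (d → g i < g j) ∧ (¬ d → g j < g i) := by
    induction j, hij using Nat.le_induction with
    | base =>
      have h1 := h i hi (by omega)
      have h2 := hne (m := i) (by omega)
      exact ⟨h1.2, fun hd => by have := mt h1.1 hd; simp only [Nat.succ_eq_add_one]; omega⟩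
    | succ m hm ih =>
      have h1 := h m (by omega) (by omega)
      have h2 := hne (m := m) (by omega)
      obtain ⟨ih1, ih2⟩ := ih (by omega)
      refine ⟨fun hd => (ih1 hd).trans (h1.2 hd), fun hd => ?_⟩
      have := mt h1.1 hd
      have := ih2 hd
      omega
  by_cases hd : d
  · simp [hd, key.1 hd]
  · simp [hd, (key.2 hd).le]

theorem exists_isRun_start (g : ℕ → ℕ) {t : ℕ} (ht : 0 < t) :
    ∃ r d, r < t ∧ IsRun g r t d ∧ (r = 0 ∨ ¬ (g (r - 1) < g r ↔ d)) := by
  classical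
  -- The least start of a run with the direction of the last step cannot be extended to the left.
  have hex : ∃ r, r < t ∧ IsRun g r t (g (t - 1) < g t) := by
    refine ⟨t - 1, by omega, fun i h1 h2 => ?_⟩
    obtain rfl : i = t - 1 := by omega
    rw [Nat.sub_add_cancel ht]
  refine ⟨Nat.find hex, _, (Nat.find_spec hex).1, (Nat.find_spec hex).2, ?_⟩
  by_contra! hcon
  obtain ⟨h0, h1⟩ := hcon
  refine Nat.find_min hex (m := Nat.find hex - 1) (by omega)
    ⟨by have := (Nat.find_spec hex).1; omega, fun i hi hit => ?_⟩
  by_cases hi' : Nat.find hex ≤ i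
  · exact (Nat.find_spec hex).2 i hi' hit
  · obtain rfl : i = Nat.find hex - 1 := by omega
    rwa [Nat.sub_add_cancel (by omega)]

/-- The first `w` terms of `a` are increasing positions below `n` at which `g` alternates. -/
structure IsAlternating (g : ℕ → ℕ) (n : ℕ) (a : ℕ → ℕ) (w : ℕ) : Prop where
  lt : ∀ k < w, a k < n
  strict : ∀ k, k + 1 < w → a k < a (k + 1)
  turn : ∀ k, k + 2 < w → ¬ (g (a k) < g (a (k + 1)) ↔ g (a (k + 1)) < g (a (k + 2)))

theorem IsAlternating.lt_of_lt {g : ℕ → ℕ} {n w : ℕ} {a : ℕ → ℕ} (h : IsAlternating g n a w)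
    {k l : ℕ} (hkl : k < l) (hl : l < w) : a k < a l := by
  induction l, hkl using Nat.le_induction with
  | base => exact h.strict k hl
  | succ m hm ih => exact (ih (by omega)).trans (h.strict m hl)

theorem IsAlternating.le_of_le {g : ℕ → ℕ} {n w : ℕ} {a : ℕ → ℕ} (h : IsAlternating g n a w)
    {k l : ℕ} (hkl : k ≤ l) (hl : l < w) : a k ≤ a l := by
  rcases hkl.eq_or_lt with rfl | hlt
  · exact le_rfl
  · exact (h.lt_of_lt hlt hl).le

/-- The number of terms of `a` in the interval `[x, y)`. -/
def hits (a : ℕ → ℕ) (w x y : ℕ) : ℕ :=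
  (((Finset.range w).image a) ∩ Finset.Ico x y).card

theorem hits_le_hits (a : ℕ → ℕ) (w : ℕ) {x x' y y' : ℕ} (hx : x' ≤ x) (hy : y ≤ y') :
    hits a w x y ≤ hits a w x' y' :=
  Finset.card_le_card (Finset.inter_subset_inter_left (Finset.Ico_subset_Ico hx hy))

theorem exists_index_of_lt_hits {a : ℕ → ℕ} {w x y c : ℕ} (hc : c < hits a w x y) :
    ∃ k l, k + c ≤ l ∧ l < w ∧ x ≤ a k ∧ a l < y := by
  set K := (Finset.range w).filter fun k => a k ∈ Finset.Ico x y with hK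
  have h1 : hits a w x y ≤ K.card := by
    refine (Finset.card_le_card (t := K.image a) fun z hz => ?_).trans Finset.card_image_le
    simp only [hK, Finset.mem_inter, Finset.mem_image, Finset.mem_filter] at hz ⊢
    obtain ⟨⟨k, hk, rfl⟩, hz⟩ := hz
    exact ⟨k, ⟨hk, hz⟩, rfl⟩
  have hne : K.Nonempty := Finset.card_pos.1 (by omega)
  have h2 : K.card ≤ K.max' hne + 1 - K.min' hne := by
    rw [← Nat.card_Icc]
    exact Finset.card_le_card fun z hz =>
      Finset.mem_Icc.2 ⟨Finset.min'_le _ _ hz, Finset.le_max' _ _ hz⟩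
  have hmin := Finset.mem_filter.1 (K.min'_mem hne)
  have hmax := Finset.mem_filter.1 (K.max'_mem hne)
  rw [Finset.mem_range, Finset.mem_Ico] at hmin hmax
  exact ⟨K.min' hne, K.max' hne, by omega, hmax.1, hmin.2.1, hmax.2.2⟩

/-- Three terms in one run would give two consecutive steps in the same direction. -/
theorem IsAlternating.hits_run_le_two {g : ℕ → ℕ} {n w r t : ℕ} {a : ℕ → ℕ} {d : Prop}
    (hg : Set.InjOn g (Set.Iio n)) (h : IsAlternating g n a w) (hr : IsRun g r t d) (ht : t < n) :
    hits a w r (t + 1) ≤ 2 := by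
  by_contra! hcon
  obtain ⟨k, l, hkl, hl, hk, hlt⟩ := exists_index_of_lt_hits hcon
  have h1 := h.lt_of_lt (show k < k + 1 by omega) (by omega)
  have h2 := h.lt_of_lt (show k + 1 < k + 2 by omega) (by omega)
  have h3 := h.le_of_le hkl hl
  refine h.turn k (by omega) ?_
  rw [hr.lt_iff hg ht hk h1 (by omega), hr.lt_iff hg ht (by omega) h2 (by omega)]

/-- Suppose there were two terms beyond `r`, and let `m` index the last term before `r`. The step
into `a m` follows the earlier run and the step out of `a (m + 1)` follows the later one. These
steps are two apart, so alternation gives them the same direction, but the runs have opposite ones.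
-/
theorem IsAlternating.hits_run_le_one {g : ℕ → ℕ} {n w p r t : ℕ} {a : ℕ → ℕ} {d d' : Prop}
    (hg : Set.InjOn g (Set.Iio n)) (h : IsAlternating g n a w) (hr' : IsRun g p r d')
    (hr : IsRun g r t d) (hd : ¬ (d' ↔ d)) (hrt : r < t) (ht : t < n)
    (h2 : 2 ≤ hits a w p r) : hits a w (r + 1) (t + 1) ≤ 1 := by
  by_contra! hcon
  obtain ⟨k, l, hkl, hl, hk, hlr⟩ := exists_index_of_lt_hits h2
  obtain ⟨k', l', hkl', hl', hk', hlt⟩ := exists_index_of_lt_hits hcon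
  have hlk : l < k' := by
    by_contra! hle
    have := h.le_of_le hle hl
    omega
  obtain ⟨m, hlm, hmk, hm, hm'⟩ : ∃ m, l ≤ m ∧ m < k' ∧ a m < r ∧ r ≤ a (m + 1) := by
    by_contra! hno
    have : ∀ m, l ≤ m → m ≤ k' → a m < r := by
      intro m hm
      induction m, hm using Nat.le_induction with
      | base => exact fun _ => hlr
      | succ m hm ih => exact fun hmk => hno m hm (by omega) (ih (by omega))
    have := this k' hlk.le le_rfl
    omega
  obtain ⟨m, rfl⟩ : ∃ m', m = m' + 1 := ⟨m - 1, by omega⟩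
  have s0 := h.lt_of_lt (show m < m + 1 by omega) (by omega)
  have s1 := h.lt_of_lt (show m + 1 < m + 2 by omega) (by omega)
  have s2 := h.lt_of_lt (show m + 2 < m + 3 by omega) (by omega)
  have s3 := h.le_of_le (show k ≤ m by omega) (by omega)
  have s4 := h.le_of_le (show m + 2 ≤ k' by omega) (by omega)
  have s5 := h.le_of_le (show m + 3 ≤ l' by omega) (by omega)
  have s6 := h.lt_of_lt (show k' < l' by omega) (by omega)
  have t0 := h.turn m (by omega)
  have t1 := h.turn (m + 1) (by omega)
  have e0 := hr'.lt_iff hg (by omega) (by omega) s0 hm.le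
  have e2 := hr.lt_iff hg ht hm' s2 (by omega)
  rw [e0] at t0
  rw [e2] at t1
  tauto

/-! ### Upper bound: positions missed by twins -/

/-- The number of positions in `[x, y)` that are used by neither `a` nor `b`. -/
def misses (a b : ℕ → ℕ) (w x y : ℕ) : ℕ :=
  (Finset.Ico x y \ ((Finset.range w).image a ∪ (Finset.range w).image b)).card

theorem misses_add (a b : ℕ → ℕ) (w : ℕ) {x y z : ℕ} (hxy : x ≤ y) (hyz : y ≤ z) :
    misses a b w x y + misses a b w y z = misses a b w x z := by
  rw [misses, misses, misses, ← Finset.card_union_of_disjoint, ← Finset.union_sdiff_distrib,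
    Finset.Ico_union_Ico_eq_Ico hxy hyz]
  exact Finset.disjoint_of_subset_left Finset.sdiff_subset
    (Finset.disjoint_of_subset_right Finset.sdiff_subset (Finset.Ico_disjoint_Ico_consecutive x y z))

theorem le_misses_add_hits (a b : ℕ → ℕ) (w x y : ℕ) :
    y ≤ misses a b w x y + hits a w x y + hits b w x y + x := by
  have h : (Finset.Ico x y).card ≤ misses a b w x y + (hits a w x y + hits b w x y) := by
    refine le_trans (Finset.card_le_card fun z hz => ?_) ((Finset.card_union_le _ _).trans
      (Nat.add_le_add_left (Finset.card_union_le _ _) _))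
    simp only [Finset.mem_union, Finset.mem_sdiff, Finset.mem_inter]
    tauto
  rw [Nat.card_Ico] at h
  omega

/-- The five positions starting at `i` are monotone. -/
def MonotoneFive (g : ℕ → ℕ) (i : ℕ) : Prop :=
  (g i < g (i + 1) ↔ g (i + 1) < g (i + 2)) ∧ (g (i + 1) < g (i + 2) ↔ g (i + 2) < g (i + 3)) ∧
    (g (i + 2) < g (i + 3) ↔ g (i + 3) < g (i + 4))

open Classical in
/-- The number of monotone windows of length five that end at `t` or before. -/
noncomputable def monotoneCount (g : ℕ → ℕ) (t : ℕ) : ℕ :=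
  ((Finset.range (t - 3)).filter (MonotoneFive g)).card

/-- The direction changes at `r`, so a monotone window either ends by `r` or lies inside the last
run. -/
theorem monotoneCount_le {g : ℕ → ℕ} {r t : ℕ} {d : Prop} (hr : IsRun g r t d)
    (h0 : r = 0 ∨ ¬ (g (r - 1) < g r ↔ d)) :
    monotoneCount g t ≤ monotoneCount g r + (t - 3 - r) := by
  classical
  rw [← Nat.card_Ico]
  refine (Finset.card_le_card fun i hi => ?_).trans (Finset.card_union_le _ _)
  rw [Finset.mem_filter, Finset.mem_range] at hi
  obtain ⟨hit, h1, h2, h3⟩ := hi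
  rw [Finset.mem_union, Finset.mem_filter, Finset.mem_range, Finset.mem_Ico]
  by_cases hri : r ≤ i
  · exact Or.inr ⟨hri, hit⟩
  by_cases hir : i < r - 3
  · exact Or.inl ⟨hir, h1, h2, h3⟩
  exfalso
  rcases h0 with h0 | h0
  · omega
  have hlast := hr (i + 3) (by omega) (by omega)
  rw [show i + 3 + 1 = i + 4 from rfl] at hlast
  obtain rfl | rfl | rfl : r = i + 1 ∨ r = i + 2 ∨ r = i + 3 := by omega
  all_goals simp only [Nat.add_sub_cancel, show i + 2 - 1 = i + 1 by omega,
    show i + 3 - 1 = i + 2 by omega] at h0; tauto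

/-- The second clause strengthens the induction to cope with the endpoint shared by two runs. Either
the bound already holds without position `t`, so the next run may count `t` as its own, or both
twins have two terms in the run before `t`, and then each has at most one term in the next run
beyond `t`. -/
theorem monotoneCount_le_misses {g : ℕ → ℕ} {n w : ℕ} {a b : ℕ → ℕ}
    (hg : Set.InjOn g (Set.Iio n)) (ha : IsAlternating g n a w) (hb : IsAlternating g n b w)
    {t : ℕ} (ht : t < n) :
    monotoneCount g t ≤ misses a b w 0 (t + 1) ∧
      ∀ r d, r < t → IsRun g r t d → (r = 0 ∨ ¬ (g (r - 1) < g r ↔ d)) →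
        monotoneCount g t ≤ misses a b w 0 t ∨ 2 ≤ hits a w r t ∧ 2 ≤ hits b w r t := by
  induction t using Nat.strong_induction_on with
  | _ t ih =>
  have key : ∀ r d, r < t → IsRun g r t d → (r = 0 ∨ ¬ (g (r - 1) < g r ↔ d)) →
      monotoneCount g t ≤ misses a b w 0 (t + 1) ∧
        (monotoneCount g t ≤ misses a b w 0 t ∨ 2 ≤ hits a w r t ∧ 2 ≤ hits b w r t) := by
    intro r d hrt hr h0
    have hN := monotoneCount_le hr h0
    have hlast := misses_add a b w (Nat.zero_le t) (show t ≤ t + 1 by omega)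
    obtain ⟨ih1, ih2⟩ := ih r hrt (by omega)
    have hsplit := misses_add a b w (Nat.zero_le (r + 1)) hrt
    by_cases hshort : t ≤ r + 3
    · omega
    -- Here `r` is still free to be charged: the `t + 1 - r` positions of the run contain at most
    -- four hits. Dropping `t` costs nothing unless all four hits precede it.
    have first : monotoneCount g r ≤ misses a b w 0 r →
        monotoneCount g t ≤ misses a b w 0 (t + 1) ∧
        (monotoneCount g t ≤ misses a b w 0 t ∨ 2 ≤ hits a w r t ∧ 2 ≤ hits b w r t) := by
      intro hle
      have h1 := misses_add a b w (Nat.zero_le r) hrt.le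
      have h2 := misses_add a b w (Nat.zero_le r) (show r ≤ t + 1 by omega)
      have h3 := le_misses_add_hits a b w r t
      have h4 := le_misses_add_hits a b w r (t + 1)
      have h5 := ha.hits_run_le_two hg hr ht
      have h6 := hb.hits_run_le_two hg hr ht
      have h7 := hits_le_hits a w (le_refl r) (show t ≤ t + 1 by omega)
      have h8 := hits_le_hits b w (le_refl r) (show t ≤ t + 1 by omega)
      omega
    rcases Nat.eq_zero_or_pos r with hr0 | hrpos
    · subst hr0
      exact first (by simp [monotoneCount])
    obtain ⟨p, d', hpr, hp, hp0⟩ := exists_isRun_start g hrpos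
    have hdd : ¬ (d' ↔ d) := by
      have := hp (r - 1) (by omega) (by omega)
      rw [Nat.sub_add_cancel hrpos] at this
      rw [← this]
      exact h0.resolve_left hrpos.ne'
    rcases ih2 p d' hpr hp hp0 with hle | ⟨hA, hB⟩
    · exact first hle
    -- Position `r` is already charged, but only two hits remain beyond it, so `[r + 1, t)` alone
    -- has at least `t - r - 3` misses.
    have h1 := ha.hits_run_le_one hg hp hr hdd hrt ht hA
    have h2 := hb.hits_run_le_one hg hp hr hdd hrt ht hB
    have h3 := hits_le_hits a w (le_refl (r + 1)) (show t ≤ t + 1 by omega)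
    have h4 := hits_le_hits b w (le_refl (r + 1)) (show t ≤ t + 1 by omega)
    have h5 := le_misses_add_hits a b w (r + 1) t
    omega
  refine ⟨?_, fun r d h1 h2 h3 => (key r d h1 h2 h3).2⟩
  rcases Nat.eq_zero_or_pos t with rfl | hpos
  · simp [monotoneCount]
  · obtain ⟨r, d, h1, h2, h3⟩ := exists_isRun_start g hpos
    exact (key r d h1 h2 h3).1

theorem two_mul_add_monotoneCount_le {g : ℕ → ℕ} {n w : ℕ} {a b : ℕ → ℕ} (hn : 0 < n)
    (hg : Set.InjOn g (Set.Iio n)) (ha : IsAlternating g n a w) (hb : IsAlternating g n b w)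
    (hab : Disjoint ((Finset.range w).image a) ((Finset.range w).image b)) :
    2 * w + monotoneCount g (n - 1) ≤ n := by
  have h1 := (monotoneCount_le_misses hg ha hb (show n - 1 < n by omega)).1
  rw [Nat.sub_add_cancel hn, misses, Finset.card_sdiff_of_subset, Finset.card_union_of_disjoint hab]
    at h1
  · have hcard {c : ℕ → ℕ} (hc : IsAlternating g n c w) : ((Finset.range w).image c).card = w := by
      rw [Finset.card_image_of_injOn, Finset.card_range]
      intro i hi j hj hij
      simp only [Finset.coe_range, Set.mem_Iio] at hi hj
      by_contra hne
      rcases Nat.lt_or_gt_of_ne hne with hlt | hlt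
      · exact (hc.lt_of_lt hlt hj).ne hij
      · exact (hc.lt_of_lt hlt hi).ne' hij
    have hle : ((Finset.range w).image a ∪ (Finset.range w).image b).card ≤ (Finset.Ico 0 n).card := by
      refine Finset.card_le_card fun z hz => ?_
      simp only [Finset.mem_union, Finset.mem_image, Finset.mem_range] at hz
      rcases hz with ⟨k, hk, rfl⟩ | ⟨k, hk, rfl⟩
      · simpa using ha.lt k hk
      · simpa using hb.lt k hk
    rw [Finset.card_union_of_disjoint hab, hcard ha, hcard hb] at hle
    rw [hcard ha, hcard hb] at h1
    rw [Nat.card_Ico] at h1 hle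
    omega
  · intro z hz
    simp only [Finset.mem_union, Finset.mem_image, Finset.mem_range] at hz
    rcases hz with ⟨k, hk, rfl⟩ | ⟨k, hk, rfl⟩
    · simpa using ha.lt k hk
    · simpa using hb.lt k hk

/-! ### Alternating subsequences from local extrema -/

/-- `a` and `b` are consecutive elements of `S`. -/
def Consecutive (S : Finset ℕ) (a b : ℕ) : Prop :=
  a ∈ S ∧ b ∈ S ∧ a < b ∧ ∀ x ∈ S, a < x → b ≤ x

theorem Consecutive.left_unique {S : Finset ℕ} {a a' b : ℕ} (h : Consecutive S a b)
    (h' : Consecutive S a' b) : a = a' := by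
  obtain ⟨ha, -, hab, h1⟩ := h
  obtain ⟨ha', -, hab', h1'⟩ := h'
  by_contra hne
  rcases Nat.lt_or_gt_of_ne hne with hlt | hlt
  · have := h1 _ ha' hlt
    omega
  · have := h1' _ ha hlt
    omega

theorem Consecutive.right_unique {S : Finset ℕ} {a b b' : ℕ} (h : Consecutive S a b)
    (h' : Consecutive S a b') : b = b' :=
  le_antisymm (h.2.2.2 _ h'.2.1 h'.2.2.1) (h'.2.2.2 _ h.2.1 h.2.2.1)

/-- The restriction of `g` to `S` has a local extremum at `b`. -/
def IsTurn (g : ℕ → ℕ) (S : Finset ℕ) (b : ℕ) : Prop :=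
  ∃ a c, Consecutive S a b ∧ Consecutive S b c ∧ ¬ (g a < g b ↔ g b < g c)

theorem IsTurn.mem {g : ℕ → ℕ} {S : Finset ℕ} {b : ℕ} (h : IsTurn g S b) : b ∈ S := by
  obtain ⟨a, c, h, -⟩ := h
  exact h.2.1

open Classical in
/-- The local extrema of the restriction of `g` to `S`. -/
noncomputable def turns (g : ℕ → ℕ) (S : Finset ℕ) : Finset ℕ := S.filter (IsTurn g S)

theorem mem_turns {g : ℕ → ℕ} {S : Finset ℕ} {b : ℕ} : b ∈ turns g S ↔ IsTurn g S b := by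
  classical
  rw [turns, Finset.mem_filter]
  exact ⟨And.right, fun h => ⟨h.mem, h⟩⟩

theorem exists_consecutive_left {S : Finset ℕ} {e b : ℕ} (he : e ∈ S) (hb : b ∈ S) (heb : e < b) :
    ∃ a, e ≤ a ∧ Consecutive S a b := by
  have hne : (S.filter (· < b)).Nonempty := ⟨e, by simp [he, heb]⟩
  have hm := Finset.mem_filter.1 (Finset.max'_mem _ hne)
  refine ⟨(S.filter (· < b)).max' hne, Finset.le_max' _ _ (by simp [he, heb]), hm.1, hb, hm.2,
    fun x hx hlt => ?_⟩
  by_contra! hxb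
  have := Finset.le_max' (S.filter (· < b)) x (by simp [hx, hxb])
  omega

theorem exists_consecutive_right {S : Finset ℕ} {e b : ℕ} (he : e ∈ S) (hb : b ∈ S) (heb : b < e) :
    ∃ c, c ≤ e ∧ Consecutive S b c := by
  have hne : (S.filter (b < ·)).Nonempty := ⟨e, by simp [he, heb]⟩
  have hm := Finset.mem_filter.1 (Finset.min'_mem _ hne)
  exact ⟨(S.filter (b < ·)).min' hne, Finset.min'_le _ _ (by simp [he, heb]), hb, hm.1, hm.2,
    fun x hx hlt => Finset.min'_le _ _ (by simp [hx, hlt])⟩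

/-- The terms of `f` up to index `m` are increasing positions in `S` at which `g` alternates,
starting with a step up if and only if `c` holds. -/
structure IsZigzag (g : ℕ → ℕ) (S : Finset ℕ) (f : ℕ → ℕ) (m : ℕ) (c : Prop) : Prop where
  mem : ∀ k ≤ m, f k ∈ S
  strict : ∀ k < m, f k < f (k + 1)
  step : ∀ k < m, (g (f k) < g (f (k + 1)) ↔ (Even k ↔ c))

theorem IsZigzag.append {g : ℕ → ℕ} {S : Finset ℕ} {f : ℕ → ℕ} {m t : ℕ} {c : Prop}
    (h : IsZigzag g S f m c) (ht : t ∈ S) (hlt : f m < t)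
    (hs : g (f m) < g t ↔ (Even m ↔ c)) :
    IsZigzag g S (fun k => if k ≤ m then f k else t) (m + 1) c where
  mem k hk := by
    split_ifs with h1
    · exact h.mem k h1
    · exact ht
  strict k hk := by
    rw [if_pos (by omega)]
    split_ifs with h1
    · exact h.strict k h1
    · obtain rfl : k = m := by omega
      exact hlt
  step k hk := by
    rw [if_pos (by omega)]
    split_ifs with h1
    · exact h.step k h1
    · obtain rfl : k = m := by omega
      exact hs

theorem IsZigzag.dropLast {g : ℕ → ℕ} {S : Finset ℕ} {f : ℕ → ℕ} {m : ℕ} {c : Prop}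
    (h : IsZigzag g S f (m + 1) c) : IsZigzag g S f m c :=
  ⟨fun k hk => h.mem k (by omega), fun k hk => h.strict k (by omega),
    fun k hk => h.step k (by omega)⟩

/-- Greedy construction along `S`: the zigzag always ends at the current element, and its last step
has the direction of the last step in `S`. Each turn passed lengthens it by one. -/
theorem exists_isZigzag_of_consecutive {g : ℕ → ℕ} {S : Finset ℕ} (hg : Set.InjOn g S) {t : ℕ} :
    ∀ p, Consecutive S p t → ∃ m f c, IsZigzag g S f (m + 1) c ∧ f (m + 1) = t ∧
      (g (f m) < g t ↔ g p < g t) ∧ ((turns g S).filter (· < t)).card ≤ m := by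
  induction t using Nat.strong_induction_on with
  | _ t ih =>
  intro p hpt
  have ht : t ∈ S := hpt.2.1
  by_cases hq : ∃ q, Consecutive S q p
  · obtain ⟨q, hqp⟩ := hq
    obtain ⟨m, f, c, hz, hfp, hdir, hcard⟩ := ih p hpt.2.2.1 q hqp
    have hstep := hz.step m (by omega)
    have hfm := hz.strict m (by omega)
    rw [hfp] at hstep hfm
    have hne1 : g (f m) ≠ g p := fun h => hfm.ne (hg (hz.mem m (by omega)) hpt.1 h)
    have hne2 : g p ≠ g t := fun h => hpt.2.2.1.ne (hg hpt.1 ht h)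
    have hsub : (turns g S).filter (· < t) ⊆ insert p ((turns g S).filter (· < p)) := by
      intro b hb
      rw [Finset.mem_filter] at hb
      rw [Finset.mem_insert, Finset.mem_filter]
      by_contra! hcon
      have hpb : p < b := lt_of_le_of_ne (hcon.2 hb.1) (Ne.symm hcon.1)
      have := hpt.2.2.2 b (mem_turns.1 hb.1).mem hpb
      omega
    -- If the direction persists, `p` is not a turn and `t` replaces it as last term; otherwise `t`
    -- is appended.
    by_cases hsame : g q < g p ↔ g p < g t
    · have hlast : g (f m) < g t ↔ g p < g t := by
        rw [hsame] at hdir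
        constructor <;> intro h
        · by_contra hc
          have := mt hdir.1 hc
          omega
        · exact (hdir.2 h).trans h
      refine ⟨m, _, c, hz.dropLast.append ht (hfm.trans hpt.2.2.1) ?_, ?_, ?_, ?_⟩
      · rw [hlast, ← hsame, ← hdir, hstep]
      · simp
      · simpa using hlast
      · refine (Finset.card_le_card fun b hb => ?_).trans hcard
        rcases Finset.mem_insert.1 (hsub hb) with rfl | h
        · obtain ⟨a, d, h1, h2, h3⟩ := mem_turns.1 (Finset.mem_filter.1 hb).1
          obtain rfl := h1.left_unique hqp
          obtain rfl := h2.right_unique hpt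
          exact absurd hsame h3
        · exact h
    · refine ⟨m + 1, _, c, hz.append ht (by rw [hfp]; exact hpt.2.2.1) ?_, ?_, ?_, ?_⟩
      · rw [hfp, Nat.even_add_one]
        tauto
      · simp
      · simp [hfp]
      · exact (Finset.card_le_card hsub).trans ((Finset.card_insert_le _ _).trans (by omega))
  · refine ⟨0, fun k => if k ≤ 0 then p else t, g p < g t, ?_, by simp, by simp, ?_⟩
    · refine IsZigzag.append (f := fun _ => p) ⟨fun _ _ => hpt.1, by simp, by simp⟩ ht hpt.2.2.1 ?_
      simp
    · rw [Nat.le_zero, Finset.card_eq_zero, Finset.filter_eq_empty_iff]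
      intro b hb hbt
      obtain ⟨a, d, h1, h2, -⟩ := mem_turns.1 hb
      rcases lt_trichotomy b p with h | rfl | h
      · obtain ⟨q, -, hqp⟩ := exists_consecutive_left h1.2.1 hpt.1 h
        exact hq ⟨q, hqp⟩
      · exact hq ⟨a, h1⟩
      · have := hpt.2.2.2 b h1.2.1 h
        omega

/-- A sequence contains an alternating subsequence, starting with a step up, that is at least as
long as the number of its local extrema. -/
theorem exists_alternating_of_turns {g : ℕ → ℕ} {S : Finset ℕ} (hg : Set.InjOn g S) :
    ∃ f : ℕ → ℕ, (∀ k < (turns g S).card, f k ∈ S) ∧ ∀ k, k + 1 < (turns g S).card →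
      f k < f (k + 1) ∧ (g (f k) < g (f (k + 1)) ↔ Even k) := by
  rcases (turns g S).eq_empty_or_nonempty with hempty | hne
  · exact ⟨id, by simp [hempty]⟩
  obtain ⟨a, t, h1, h2, -⟩ := mem_turns.1 ((turns g S).max'_mem hne)
  obtain ⟨m, f, c, hz, -, -, hcard⟩ := exists_isZigzag_of_consecutive hg _ h2
  have hm : (turns g S).card ≤ m := by
    refine (Finset.card_le_card fun b hb => ?_).trans hcard
    exact Finset.mem_filter.2 ⟨hb, (Finset.le_max' _ b hb).trans_lt h2.2.2.1⟩
  by_cases hc : c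
  · refine ⟨f, fun k hk => hz.mem k (by omega), fun k hk => ⟨hz.strict k (by omega), ?_⟩⟩
    rw [hz.step k (by omega)]
    tauto
  -- A zigzag that starts downward loses its first term; of its `m + 2` terms enough remain.
  · refine ⟨fun k => f (k + 1), fun k hk => hz.mem _ (by omega),
      fun k hk => ⟨hz.strict _ (by omega), ?_⟩⟩
    rw [hz.step _ (by omega), Nat.even_add_one]
    tauto

/-! ### Lower bound: turns among extrema and among non-extrema -/

/-- `g` has a local extremum at `i`. -/
def IsExtremum (g : ℕ → ℕ) (i : ℕ) : Prop := ¬ (g (i - 1) < g i ↔ g i < g (i + 1))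

theorem isRun_of_no_extremum {g : ℕ → ℕ} {a b : ℕ}
    (h : ∀ i, a < i → i < b → ¬ IsExtremum g i) : IsRun g a b (g a < g (a + 1)) := by
  intro i hai
  induction i, hai using Nat.le_induction with
  | base => exact fun _ => Iff.rfl
  | succ m hm ih =>
    intro hlt
    have := h (m + 1) (by omega) hlt
    rw [IsExtremum, not_not, Nat.add_sub_cancel] at this
    rw [← this]
    exact ih (by omega)

/-- No extremum of `g` lies strictly between consecutive elements of `S` here, so `g` is monotone
between them and the extremum at `b` survives the restriction. -/
theorem isTurn_of_isExtremum {g : ℕ → ℕ} {n x y e b e' : ℕ} {S : Finset ℕ}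
    (hg : Set.InjOn g (Set.Iio n)) (hS : S ⊆ Finset.Ico 1 (n - 1)) (hy : y ≤ n)
    (hSext : ∀ i ∈ Finset.Ico 1 (n - 1), x ≤ i → i < y → (i ∈ S ↔ IsExtremum g i))
    (he : e ∈ S) (hb : b ∈ S) (he' : e' ∈ S) (hxe : x ≤ e) (heb : e < b) (hbe' : b < e')
    (hey : e' < y) : IsTurn g S b := by
  obtain ⟨a, hea, hab⟩ := exists_consecutive_left he hb heb
  obtain ⟨c, hce, hbc⟩ := exists_consecutive_right he' hb hbe'
  have ha := Finset.mem_Ico.1 (hS hab.1)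
  have hc := Finset.mem_Ico.1 (hS hbc.2.1)
  have hab' := hab.2.2.1
  have hbc' := hbc.2.2.1
  have r1 : IsRun g a b (g a < g (a + 1)) := isRun_of_no_extremum fun i h1 h2 h3 => by
    have := hab.2.2.2 i ((hSext i (Finset.mem_Ico.2 ⟨by omega, by omega⟩) (by omega)
      (by omega)).2 h3) h1
    omega
  have r2 : IsRun g b c (g b < g (b + 1)) := isRun_of_no_extremum fun i h1 h2 h3 => by
    have := hbc.2.2.2 i ((hSext i (Finset.mem_Ico.2 ⟨by omega, by omega⟩) (by omega)
      (by omega)).2 h3) h1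
    omega
  refine ⟨a, c, hab, hbc, ?_⟩
  rw [r1.lt_iff hg (by omega) le_rfl hab' le_rfl, r2.lt_iff hg (by omega) le_rfl hbc' le_rfl]
  have hext := (hSext b (hS hb) (by omega) (by omega)).1 hb
  have h1 := r1 (b - 1) (by omega) (by omega)
  rw [Nat.sub_add_cancel (by omega)] at h1
  rwa [IsExtremum, h1] at hext

/-- The three entries of `x` are not monotone. -/
def TurnPattern (x : Fin 3 → ℕ) : Prop := ¬ (x 0 < x 1 ↔ x 1 < x 2)

/-- The six entries of `x` contain two monotone runs, one of them with two interior entries and the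
other with one, and the three interior entries are not monotone. -/
def InteriorTurnPattern (x : Fin 6 → ℕ) : Prop :=
  (x 0 < x 1 ↔ x 1 < x 2) ∧ (x 3 < x 4 ↔ x 4 < x 5) ∧ ¬ (x 1 < x 2 ↔ x 3 < x 4) ∧
    ((x 1 < x 2 ↔ x 2 < x 3) ∧ ¬ (x 1 < x 2 ↔ x 2 < x 4) ∨
      (x 2 < x 3 ↔ x 3 < x 4) ∧ ¬ (x 1 < x 3 ↔ x 3 < x 4))

open Classical in
-- The loss of 2 accounts for the first and last extremum in `[x, y)`, whose neighbours in `S` may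
-- lie outside. The cutoff `y - 6` merely matches that of the six-entry pattern.
theorem card_turnPattern_le {g : ℕ → ℕ} {n x y : ℕ} {S : Finset ℕ}
    (hg : Set.InjOn g (Set.Iio n)) (hS : S ⊆ Finset.Ico 1 (n - 1)) (hy : y ≤ n)
    (hSext : ∀ i ∈ Finset.Ico 1 (n - 1), x ≤ i → i < y → (i ∈ S ↔ IsExtremum g i)) :
    ((Finset.Ico x (y - 6)).filter fun i => TurnPattern fun j => g (i + j)).card ≤
      ((turns g S).filter (· ∈ Finset.Ico x y)).card + 2 := by
  set E := S.filter (· ∈ Finset.Ico x y) with hE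
  have h1 : ((Finset.Ico x (y - 6)).filter fun i => TurnPattern fun j => g (i + j)).card ≤
      E.card := by
    refine Finset.card_le_card_of_injOn (· + 1) (fun i hi => ?_) fun i _ j _ hij => by
      simpa using hij
    simp only [Finset.coe_filter, Set.mem_ofPred_eq, Finset.mem_Ico] at hi
    have hmem := (hSext (i + 1) (Finset.mem_Ico.2 ⟨by omega, by omega⟩) (by omega)
      (by omega)).2 hi.2
    simp only [hE, Finset.coe_filter, Set.mem_ofPred_eq, Finset.mem_Ico]
    exact ⟨hmem, by omega, by omega⟩
  refine h1.trans ?_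
  rcases E.eq_empty_or_nonempty with hemp | hne
  · simp [hemp]
  have hmin := Finset.mem_filter.1 (E.min'_mem hne)
  have hmax := Finset.mem_filter.1 (E.max'_mem hne)
  rw [Finset.mem_Ico] at hmin hmax
  have hsub : E ⊆ ((turns g S).filter (· ∈ Finset.Ico x y)) ∪ {E.min' hne, E.max' hne} := by
    intro b hb
    have hb' := Finset.mem_filter.1 hb
    rw [Finset.mem_union, Finset.mem_filter, mem_turns]
    by_cases hbm : b = E.min' hne
    · simp [hbm]
    by_cases hbM : b = E.max' hne
    · simp [hbM]
    exact Or.inl ⟨isTurn_of_isExtremum hg hS hy hSext hmin.1 hb'.1 hmax.1 hmin.2.1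
      (lt_of_le_of_ne (Finset.min'_le _ _ hb) (Ne.symm hbm))
      (lt_of_le_of_ne (Finset.le_max' _ _ hb) hbM) hmax.2.2, hb'.2⟩
  exact (Finset.card_le_card hsub).trans ((Finset.card_union_le _ _).trans
    (Nat.add_le_add_left Finset.card_le_two _))

open Classical in
-- In such a window offsets 1 and 4 are non-extrema, and so is exactly one of offsets 2 and 3. These
-- three are consecutive in `S` and not monotone, so the middle one is a turn, and the window is
-- charged to it.
theorem card_interiorTurnPattern_le {g : ℕ → ℕ} {n x y : ℕ} {S : Finset ℕ} (hy : y ≤ n)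
    (hSint : ∀ i ∈ Finset.Ico 1 (n - 1), x ≤ i → i < y → (i ∈ S ↔ ¬ IsExtremum g i)) :
    ((Finset.Ico x (y - 6)).filter fun i => InteriorTurnPattern fun j => g (i + j)).card ≤
      ((turns g S).filter (· ∈ Finset.Ico x y)).card := by
  refine Finset.card_le_card_of_injOn
    (fun i => if (g (i + 2) < g (i + 3) ↔ g (i + 3) < g (i + 4)) then i + 3 else i + 2) ?_ ?_
  · intro i hi
    simp only [Finset.coe_filter, Set.mem_ofPred_eq, Finset.mem_Ico] at hi
    obtain ⟨⟨hxi, hiy⟩, p1, p2, p3, p4⟩ := hi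
    change (g i < g (i + 1) ↔ g (i + 1) < g (i + 2)) at p1
    change (g (i + 3) < g (i + 4) ↔ g (i + 4) < g (i + 5)) at p2
    change ¬ (g (i + 1) < g (i + 2) ↔ g (i + 3) < g (i + 4)) at p3
    change ((g (i + 1) < g (i + 2) ↔ g (i + 2) < g (i + 3)) ∧
      ¬ (g (i + 1) < g (i + 2) ↔ g (i + 2) < g (i + 4)) ∨
      (g (i + 2) < g (i + 3) ↔ g (i + 3) < g (i + 4)) ∧
      ¬ (g (i + 1) < g (i + 3) ↔ g (i + 3) < g (i + 4))) at p4
    have mem (l : ℕ) (hl : l < 4) : i + (l + 1) ∈ S ↔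
        (g (i + l) < g (i + (l + 1)) ↔ g (i + (l + 1)) < g (i + (l + 2))) := by
      rw [hSint (i + (l + 1)) (Finset.mem_Ico.2 ⟨by omega, by omega⟩) (by omega) (by omega),
        IsExtremum, not_not]
      rfl
    have m1 := mem 0 (by omega)
    have m2 := mem 1 (by omega)
    have m3 := mem 2 (by omega)
    have m4 := mem 3 (by omega)
    simp only [Nat.reduceAdd, Nat.add_zero] at m1 m2 m3 m4
    have h1 : i + 1 ∈ S := m1.2 p1
    have h4 : i + 4 ∈ S := m4.2 p2
    simp only [Finset.coe_filter, Set.mem_ofPred_eq, Finset.mem_Ico, mem_turns]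
    split_ifs with hc
    · have h3 : i + 3 ∈ S := m3.2 hc
      have h2 : i + 2 ∉ S := fun h => p3 ((m2.1 h).trans hc)
      refine ⟨⟨i + 1, i + 4, ⟨h1, h3, by omega, fun z hz hlt => ?_⟩,
        ⟨h3, h4, by omega, fun z _ hlt => by omega⟩, ?_⟩, by omega, by omega⟩
      · by_contra! hzlt
        obtain rfl : z = i + 2 := by omega
        exact h2 hz
      · rcases p4 with ⟨q1, -⟩ | ⟨-, q2⟩
        · exact absurd (q1.trans hc) p3
        · exact q2
    · have h3 : i + 3 ∉ S := by rwa [m3]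
      have h2 : i + 2 ∈ S := m2.2 (p4.elim And.left fun q => absurd q.1 hc)
      refine ⟨⟨i + 1, i + 4, ⟨h1, h2, by omega, fun z _ hlt => by omega⟩,
        ⟨h2, h4, by omega, fun z hz hlt => ?_⟩, ?_⟩, by omega, by omega⟩
      · by_contra! hzlt
        obtain rfl : z = i + 3 := by omega
        exact h3 hz
      · rcases p4 with ⟨-, q2⟩ | ⟨q1, -⟩
        · exact q2
        · exact absurd q1 hc
  -- Two windows charged to the same turn could only start at `i` and `i + 1`, but then `i + 4`
  -- would have to be both a non-extremum and an extremum.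
  · have key (i j : ℕ) (hi : InteriorTurnPattern fun l => g (i + l))
        (hci : g (i + 2) < g (i + 3) ↔ g (i + 3) < g (i + 4))
        (hcj : ¬ (g (j + 2) < g (j + 3) ↔ g (j + 3) < g (j + 4))) : i + 3 ≠ j + 2 := by
      intro hij
      obtain rfl : j = i + 1 := by omega
      have h2 : g (i + 3) < g (i + 4) ↔ g (i + 4) < g (i + 5) := hi.2.1
      have e1 : i + 1 + 2 = i + 3 := rfl
      have e2 : i + 1 + 3 = i + 4 := rfl
      have e3 : i + 1 + 4 = i + 5 := rfl
      rw [e1, e2, e3] at hcj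
      exact hcj h2
    intro i hi j hj hij
    simp only [Finset.coe_filter, Set.mem_ofPred_eq] at hi hj
    dsimp only at hij
    split_ifs at hij with h1 h2 h2
    · omega
    · exact absurd hij (key i j hi.2 h1 h2)
    · exact absurd hij.symm (key j i hj.2 h2 h1)
    · omega

/-- The interior positions below `h` at which `g` has an extremum, and those from `h` on at which
it has none (with the roles exchanged if `d` fails). -/
noncomputable def mixedPositions (g : ℕ → ℕ) (n h : ℕ) (d : Prop) : Finset ℕ :=
  open Classical in (Finset.Ico 1 (n - 1)).filter fun i => (i < h ↔ IsExtremum g i) ↔ d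

theorem mem_mixedPositions {g : ℕ → ℕ} {n h i : ℕ} {d : Prop} :
    i ∈ mixedPositions g n h d ↔
      i ∈ Finset.Ico 1 (n - 1) ∧ ((i < h ↔ IsExtremum g i) ↔ d) := by
  classical
  rw [mixedPositions, Finset.mem_filter]

theorem mixedPositions_subset (g : ℕ → ℕ) (n h : ℕ) (d : Prop) :
    mixedPositions g n h d ⊆ Finset.Ico 1 (n - 1) := fun _ hi => (mem_mixedPositions.1 hi).1

open Classical in
theorem card_filter_Ico_add_card_filter_Ico_le (T : Finset ℕ) (x y z : ℕ) :
    (T.filter (· ∈ Finset.Ico x y)).card + (T.filter (· ∈ Finset.Ico y z)).card ≤ T.card := by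
  rw [← Finset.card_union_of_disjoint]
  · exact Finset.card_le_card (Finset.union_subset (Finset.filter_subset _ _)
      (Finset.filter_subset _ _))
  · refine Finset.disjoint_filter.2 fun i _ h4 h5 => ?_
    rw [Finset.mem_Ico] at h4 h5
    omega

open Classical in
theorem card_patterns_le_turns_true {g : ℕ → ℕ} {n h : ℕ} (hg : Set.InjOn g (Set.Iio n))
    (hh : h ≤ n) :
    ((Finset.Ico 0 (h - 6)).filter fun i => TurnPattern fun j => g (i + j)).card +
      ((Finset.Ico h (n - 6)).filter fun i => InteriorTurnPattern fun j => g (i + j)).card ≤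
      (turns g (mixedPositions g n h True)).card + 2 := by
  have h1 := card_turnPattern_le (x := 0) (y := h) (S := mixedPositions g n h True) hg
    (mixedPositions_subset _ _ _ _) hh
    fun i hi _ hih => by simp [mem_mixedPositions, hih, Finset.mem_Ico.1 hi]
  have h2 := card_interiorTurnPattern_le (g := g) (x := h) (y := n) (S := mixedPositions g n h True)
    le_rfl fun i hi hih _ => by simp [mem_mixedPositions, hih.not_gt, Finset.mem_Ico.1 hi]
  have h3 := card_filter_Ico_add_card_filter_Ico_le (turns g (mixedPositions g n h True)) 0 h n
  omega

open Classical in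
theorem card_patterns_le_turns_false {g : ℕ → ℕ} {n h : ℕ} (hg : Set.InjOn g (Set.Iio n))
    (hh : h ≤ n) :
    ((Finset.Ico 0 (h - 6)).filter fun i => InteriorTurnPattern fun j => g (i + j)).card +
      ((Finset.Ico h (n - 6)).filter fun i => TurnPattern fun j => g (i + j)).card ≤
      (turns g (mixedPositions g n h False)).card + 2 := by
  have h1 := card_turnPattern_le (x := h) (y := n) (S := mixedPositions g n h False) hg
    (mixedPositions_subset _ _ _ _) le_rfl
    fun i hi hih _ => by simp [mem_mixedPositions, hih.not_gt, Finset.mem_Ico.1 hi]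
  have h2 := card_interiorTurnPattern_le (g := g) (x := 0) (y := h)
    (S := mixedPositions g n h False) hh
    fun i hi _ hih => by simp [mem_mixedPositions, hih, Finset.mem_Ico.1 hi]
  have h3 := card_filter_Ico_add_card_filter_Ico_le (turns g (mixedPositions g n h False)) 0 h n
  omega

/-! ### Deterministic bounds on `alpha` by pattern counts -/

/-- The five entries of `x` are monotone. -/
def MonotonePattern (x : Fin 5 → ℕ) : Prop :=
  (x 0 < x 1 ↔ x 1 < x 2) ∧ (x 1 < x 2 ↔ x 2 < x 3) ∧ (x 2 < x 3 ↔ x 3 < x 4)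

theorem orderInvariant_monotonePattern : OrderInvariant MonotonePattern := fun x y h => by
  simp only [MonotonePattern, h]

theorem orderInvariant_turnPattern : OrderInvariant TurnPattern := fun x y h => by
  simp only [TurnPattern, h]

theorem orderInvariant_interiorTurnPattern : OrderInvariant InteriorTurnPattern := fun x y h => by
  simp only [InteriorTurnPattern, h]

/-- An increasing sequence of positions, as a sequence of natural numbers. -/
def positions {n w : ℕ} (i : Fin w ↪o Fin n) (k : ℕ) : ℕ := if h : k < w then i ⟨k, h⟩ else 0

theorem positions_of_lt {n w : ℕ} (i : Fin w ↪o Fin n) {k : ℕ} (h : k < w) :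
    positions i k = i ⟨k, h⟩ := dif_pos h

theorem value_positions {n w : ℕ} (π : Equiv.Perm (Fin n)) (i : Fin w ↪o Fin n) {k : ℕ}
    (h : k < w) : value π (positions i k) = π (i ⟨k, h⟩) := by
  rw [positions_of_lt i h, value_of_lt π (i ⟨k, h⟩).isLt]

theorem value_positions_lt_iff {n w : ℕ} (π : Equiv.Perm (Fin n)) (i : Fin w ↪o Fin n) {k : ℕ}
    (h : k + 1 < w) : value π (positions i k) < value π (positions i (k + 1)) ↔
      shape (π ∘ i) ⟨k, by omega⟩ = true := by
  rw [value_positions π i (by omega), value_positions π i h, shape, decide_eq_true_iff]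
  rfl

theorem isAlternating_positions {n w : ℕ} (π : Equiv.Perm (Fin n)) (i : Fin w ↪o Fin n)
    (h : shape (π ∘ i) = altPlus w ∨ shape (π ∘ i) = altMinus w) :
    IsAlternating (value π) n (positions i) w where
  lt k hk := by
    rw [positions_of_lt i hk]
    exact (i ⟨k, hk⟩).isLt
  strict k hk := by
    rw [positions_of_lt i hk, positions_of_lt i (show k < w by omega)]
    exact i.strictMono (Fin.mk_lt_mk.2 (Nat.lt_succ_self k))
  turn k hk := by
    rw [value_positions_lt_iff π i (by omega), value_positions_lt_iff π i hk]
    rcases h with h | h <;> rw [h]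
    · simp only [altPlus, decide_eq_true_iff, Nat.even_add_one]
      tauto
    · simp only [altMinus, decide_eq_true_iff, Nat.odd_add_one]
      tauto

theorem two_mul_add_patternCount_le {n w : ℕ} (π : Equiv.Perm (Fin n))
    (h : HasAlternatingTwins π w) :
    2 * w + patternCount MonotonePattern (Finset.range (n - 4)) π ≤ n := by
  classical
  obtain ⟨i, j, ⟨hdis, hshape⟩, halt⟩ := h
  have hi := isAlternating_positions π i halt
  have hj := isAlternating_positions π j (hshape ▸ halt)
  have hdis' : Disjoint ((Finset.range w).image (positions i))
      ((Finset.range w).image (positions j)) := by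
    rw [Finset.disjoint_left]
    intro z hz hz'
    obtain ⟨k, hk, rfl⟩ := Finset.mem_image.1 hz
    obtain ⟨l, hl, hkl⟩ := Finset.mem_image.1 hz'
    rw [Finset.mem_range] at hk hl
    rw [positions_of_lt i hk, positions_of_lt j hl] at hkl
    exact Set.disjoint_left.1 hdis ⟨⟨k, hk⟩, rfl⟩ ⟨⟨l, hl⟩, Fin.ext hkl⟩
  rcases Nat.eq_zero_or_pos n with rfl | hn
  · have hw : w = 0 := by simpa using Fintype.card_le_of_injective i i.injective
    simp [patternCount, hw]
  refine le_trans (Nat.add_le_add_left (Finset.card_le_card fun z hz => ?_) _)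
    (two_mul_add_monotoneCount_le hn (value_injOn π) hi hj hdis')
  rw [Finset.mem_filter] at hz ⊢
  exact ⟨by rw [show n - 1 - 3 = n - 4 by omega]; exact hz.1, hz.2⟩

theorem exists_embedding_of_alternating {n w : ℕ} (π : Equiv.Perm (Fin n)) {f : ℕ → ℕ}
    (hn : ∀ k < w, f k < n) (hf : ∀ k, k + 1 < w →
      f k < f (k + 1) ∧ (value π (f k) < value π (f (k + 1)) ↔ Even k)) :
    ∃ i : Fin w ↪o Fin n, (∀ k, (i k : ℕ) = f k) ∧ shape (π ∘ i) = altPlus w := by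
  have halt : IsAlternating (value π) n f w := by
    refine ⟨hn, fun k hk => (hf k hk).1, fun k hk => ?_⟩
    rw [(hf k (by omega)).2, (hf (k + 1) hk).2, Nat.even_add_one]
    tauto
  refine ⟨OrderEmbedding.ofStrictMono (fun k : Fin w => ⟨f k, hn k k.isLt⟩) fun k l hkl =>
    halt.lt_of_lt hkl l.isLt, fun k => rfl, ?_⟩
  funext k
  have h := (hf k (by omega)).2
  rw [value_of_lt π (hn k (by omega)), value_of_lt π (hn (k + 1) (by omega))] at h
  exact decide_eq_decide.2 h

/-- The two classes of mixed positions are disjoint. Both alternating subsequences start upward, so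
truncating them to the smaller number of turns gives them the same shape. -/
theorem le_alpha {n h : ℕ} (π : Equiv.Perm (Fin n)) (hh : h ≤ n) :
    min (patternCount TurnPattern (Finset.Ico 0 (h - 6)) π +
        patternCount InteriorTurnPattern (Finset.Ico h (n - 6)) π)
      (patternCount InteriorTurnPattern (Finset.Ico 0 (h - 6)) π +
        patternCount TurnPattern (Finset.Ico h (n - 6)) π) ≤ alpha π + 2 := by
  classical
  have hinj := value_injOn π
  have hlt (d : Prop) : ∀ z ∈ mixedPositions (value π) n h d, z < n := fun z hz => by
    have := Finset.mem_Ico.1 (mixedPositions_subset (value π) n h d hz)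
    omega
  have h1 := card_patterns_le_turns_true hinj hh
  have h2 := card_patterns_le_turns_false hinj hh
  set w := min (turns (value π) (mixedPositions (value π) n h True)).card
    (turns (value π) (mixedPositions (value π) n h False)).card with hw
  obtain ⟨a, ha, ha'⟩ := exists_alternating_of_turns (g := value π)
    (S := mixedPositions (value π) n h True) (hinj.mono (hlt True))
  obtain ⟨b, hb, hb'⟩ := exists_alternating_of_turns (g := value π)
    (S := mixedPositions (value π) n h False) (hinj.mono (hlt False))
  obtain ⟨i, hi, hi'⟩ := exists_embedding_of_alternating (w := w) π
    (fun k hk => hlt True _ (ha k (by omega))) (fun k hk => ha' k (by omega))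
  obtain ⟨j, hj, hj'⟩ := exists_embedding_of_alternating (w := w) π
    (fun k hk => hlt False _ (hb k (by omega))) (fun k hk => hb' k (by omega))
  have htw : HasAlternatingTwins π w := by
    refine ⟨i, j, ⟨?_, hi'.trans hj'.symm⟩, Or.inl hi'⟩
    rw [Set.disjoint_left]
    rintro _ ⟨k, rfl⟩ ⟨l, hl⟩
    have m1 := (mem_mixedPositions.1 (ha k (by omega))).2
    have m2 := (mem_mixedPositions.1 (hb l (by omega))).2
    rw [← hi k] at m1
    rw [← hj l, hl] at m2
    simp only [iff_true, iff_false] at m1 m2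
    exact m2 m1
  have hle := (isGreatest_alpha π).2 htw
  simp only [patternCount]
  omega

instance : DecidablePred MonotonePattern := fun x => by unfold MonotonePattern; infer_instance

instance : DecidablePred TurnPattern := fun x => by unfold TurnPattern; infer_instance

instance : DecidablePred InteriorTurnPattern := fun x => by
  unfold InteriorTurnPattern; infer_instance

theorem patternDensity_eq {k q : ℕ} {Q : (Fin k → ℕ) → Prop} [DecidablePred Q]
    (h : (Finset.univ.filter fun σ : Equiv.Perm (Fin k) => Q fun i => σ i).card = q) :
    patternDensity Q = q / k.factorial := by
  rw [patternDensity, ← h]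
  congr!

theorem patternDensity_monotonePattern : patternDensity MonotonePattern = 1 / 60 := by
  rw [patternDensity_eq (q := 2) (by decide +kernel)]
  norm_num [Nat.factorial]

theorem patternDensity_turnPattern : patternDensity TurnPattern = 2 / 3 := by
  rw [patternDensity_eq (q := 4) (by decide +kernel)]
  norm_num [Nat.factorial]

theorem patternDensity_interiorTurnPattern : patternDensity InteriorTurnPattern = 1 / 30 := by
  rw [patternDensity_eq (q := 24) (by decide +kernel)]
  norm_num [Nat.factorial]

/-! ### Passage to asymptotic probability -/

open Filter Topology

theorem tendsto_uniform_of_card_compl_le {s : ∀ n : ℕ, Set (Equiv.Perm (Fin n))} {c : ℕ → ℝ}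
    (hc : Tendsto c atTop (𝓝 0))
    (h : ∀ᶠ n in atTop, (Nat.card ↥(s n)ᶜ : ℝ) ≤ c n * n.factorial) :
    Tendsto (fun n => (PMF.uniformOfFintype (Equiv.Perm (Fin n))).toOuterMeasure (s n)) atTop
      (𝓝 1) := by
  classical
  have hpos (n : ℕ) : (0 : ℝ) < n.factorial := by positivity
  have heq (n : ℕ) : (PMF.uniformOfFintype (Equiv.Perm (Fin n))).toOuterMeasure (s n) =
      ENNReal.ofReal (1 - (Nat.card ↥(s n)ᶜ : ℝ) / n.factorial) := by
    have hadd : (Fintype.card ↥(s n) : ℝ) + (Nat.card ↥(s n)ᶜ : ℝ) = n.factorial := by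
      have := Fintype.card_compl_set (s n)
      have hle := set_fintype_card_le_univ (s n)
      rw [Fintype.card_perm, Fintype.card_fin] at this hle
      rw [Nat.card_eq_fintype_card, this]
      push_cast [hle]
      ring
    rw [PMF.toOuterMeasure_uniformOfFintype_apply, Fintype.card_perm, Fintype.card_fin,
      one_sub_div (hpos n).ne', ← hadd, add_sub_cancel_right, hadd,
      ENNReal.ofReal_div_of_pos (hpos n), ENNReal.ofReal_natCast, ENNReal.ofReal_natCast]
  simp_rw [heq]
  have hlim : Tendsto (fun n => (Nat.card ↥(s n)ᶜ : ℝ) / n.factorial) atTop (𝓝 0) := by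
    refine tendsto_of_tendsto_of_tendsto_of_le_of_le' tendsto_const_nhds hc
      (Eventually.of_forall fun n => by positivity) ?_
    filter_upwards [h] with n hn
    rwa [div_le_iff₀ (hpos n)]
  simpa using ENNReal.tendsto_ofReal (hlim.const_sub 1)

open Classical in
/-- The permutations of `Fin n` that contain fewer windows with `Q` than expected, by a margin. -/
noncomputable def deficient {k : ℕ} (Q : (Fin k → ℕ) → Prop) (n : ℕ) (I : Finset ℕ) (η : ℝ) :
    Finset (Equiv.Perm (Fin n)) :=
  Finset.univ.filter fun π => (patternCount Q I π : ℝ) < patternDensity Q * I.card - η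

theorem le_patternCount_of_notMem_deficient {n k : ℕ} {Q : (Fin k → ℕ) → Prop} {I : Finset ℕ}
    {η : ℝ} {π : Equiv.Perm (Fin n)} (h : π ∉ deficient Q n I η) :
    patternDensity Q * I.card - η ≤ patternCount Q I π := by
  classical
  simpa [deficient] using h

theorem card_deficient_le {n k : ℕ} {Q : (Fin k → ℕ) → Prop} (hQ : OrderInvariant Q) (hk : k ≤ 6)
    {I : Finset ℕ} (hI : ∀ i ∈ I, i + k ≤ n) (hcard : I.card ≤ n) {η : ℝ} (hη : 0 < η) :
    ((deficient Q n I η).card : ℝ) ≤ 12 * n / η ^ 2 * n.factorial := by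
  have h := card_patternCount_lt_le hQ I hI hη.le
  rw [div_mul_eq_mul_div, le_div_iff₀ (by positivity)]
  refine h.trans ?_
  have h1 : (I.card : ℝ) ≤ n := by exact_mod_cast hcard
  have h2 : (2 * k : ℝ) ≤ 12 := by
    have : (k : ℝ) ≤ 6 := by exact_mod_cast hk
    linarith
  have h3 : (I.card : ℝ) * (2 * k) ≤ n * 12 := mul_le_mul h1 h2 (by positivity) (by positivity)
  calc (I.card : ℝ) * (2 * k) * n.factorial ≤ n * 12 * n.factorial :=
        mul_le_mul_of_nonneg_right h3 (by positivity)
    _ = 12 * n * n.factorial := by ring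

/-- The slopes are 7/20 = 1/3 + 1/60 and 59/120 = 1/2 - 1/120. The additive constants generously
absorb rounding and truncated windows, and in the lower bound also the two lost turns. -/
theorem alpha_bounds {n : ℕ} {η : ℝ} {π : Equiv.Perm (Fin n)}
    (h1 : π ∉ deficient TurnPattern n (Finset.Ico 0 (n / 2 - 6)) η)
    (h2 : π ∉ deficient TurnPattern n (Finset.Ico (n / 2) (n - 6)) η)
    (h3 : π ∉ deficient InteriorTurnPattern n (Finset.Ico 0 (n / 2 - 6)) η)
    (h4 : π ∉ deficient InteriorTurnPattern n (Finset.Ico (n / 2) (n - 6)) η)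
    (h5 : π ∉ deficient MonotonePattern n (Finset.range (n - 4)) η) :
    7 / 20 * (n : ℝ) - 10 - 2 * η ≤ alpha π ∧
      (alpha π : ℝ) ≤ 59 / 120 * (n : ℝ) + 1 + η / 2 := by
  replace h1 := le_patternCount_of_notMem_deficient h1
  replace h2 := le_patternCount_of_notMem_deficient h2
  replace h3 := le_patternCount_of_notMem_deficient h3
  replace h4 := le_patternCount_of_notMem_deficient h4
  replace h5 := le_patternCount_of_notMem_deficient h5
  rw [patternDensity_turnPattern, Nat.card_Ico] at h1 h2
  rw [patternDensity_interiorTurnPattern, Nat.card_Ico] at h3 h4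
  rw [patternDensity_monotonePattern, Finset.card_range] at h5
  have c1 : (n : ℝ) ≤ 2 * ((n / 2 - 6 - 0 : ℕ) : ℝ) + 13 := by
    have : n ≤ 2 * (n / 2 - 6 - 0) + 13 := by omega
    exact_mod_cast this
  have c2 : (n : ℝ) ≤ 2 * ((n - 6 - n / 2 : ℕ) : ℝ) + 12 := by
    have : n ≤ 2 * (n - 6 - n / 2) + 12 := by omega
    exact_mod_cast this
  have c3 : (n : ℝ) ≤ ((n - 4 : ℕ) : ℝ) + 4 := by
    have : n ≤ (n - 4) + 4 := by omega
    exact_mod_cast this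
  constructor
  · have hlow := le_alpha π (Nat.div_le_self n 2)
    rcases min_le_iff.1 hlow with hlow | hlow
    all_goals
      have hlow' : ((_ : ℕ) : ℝ) ≤ ((_ : ℕ) : ℝ) := Nat.cast_le.2 hlow
      push_cast at hlow'
      linarith
  · have hup := two_mul_add_patternCount_le π (isGreatest_alpha π).1
    have hup' : ((_ : ℕ) : ℝ) ≤ ((_ : ℕ) : ℝ) := Nat.cast_le.2 hup
    push_cast at hup'
    linarith

theorem tendsto_natCast_rpow_neg {s : ℝ} (hs : 0 < s) :
    Tendsto (fun n : ℕ => (n : ℝ) ^ (-s)) atTop (𝓝 0) :=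
  (tendsto_rpow_neg_atTop hs).comp tendsto_natCast_atTop_atTop

end Twins

theorem theorem2 :
    ∃ ε δ : ℕ → ℝ,
      Filter.Tendsto ε Filter.atTop (nhds 0) ∧ Filter.Tendsto δ Filter.atTop (nhds 0) ∧
      Filter.Tendsto
        (fun n : ℕ => (PMF.uniformOfFintype (Equiv.Perm (Fin n))).toOuterMeasure
          {π | ((1 : ℝ) / 3 + 1 / 60 + ε n) * (n : ℝ) ≤ (Twins.alpha π : ℝ) ∧
            (Twins.alpha π : ℝ) ≤ ((1 : ℝ) / 2 - 1 / 120 + δ n) * (n : ℝ)})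
        Filter.atTop (nhds 1) := by
  classical
  open Twins in
  -- The margin `n * ν n` is n^(3/4): negligible against n, yet its square dominates the variance of
  -- order n.
  set ν : ℕ → ℝ := fun n => (n : ℝ) ^ (-(1 / 4) : ℝ) with hν
  have hν0 : Filter.Tendsto ν Filter.atTop (nhds 0) := tendsto_natCast_rpow_neg (by norm_num)
  have hinv : Filter.Tendsto (fun n : ℕ => (n : ℝ)⁻¹) Filter.atTop (nhds 0) :=
    tendsto_inv_atTop_nhds_zero_nat
  refine ⟨fun n => -(10 * (n : ℝ)⁻¹ + 2 * ν n), fun n => (n : ℝ)⁻¹ + ν n / 2, ?_, ?_, ?_⟩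
  · simpa using ((hinv.const_mul 10).add (hν0.const_mul 2)).neg
  · simpa using hinv.add (hν0.div_const 2)
  -- Five exceptional sets, each of proportion at most 12n / (n^(3/4))² = 12 n^(-1/2).
  refine tendsto_uniform_of_card_compl_le
    (c := fun n => 60 * (n : ℝ) ^ (-(1 / 2) : ℝ)) ?_ ?_
  · simpa using (tendsto_natCast_rpow_neg (show (0 : ℝ) < 1 / 2 by norm_num)).const_mul 60
  filter_upwards [Filter.eventually_gt_atTop 0] with n hn
  have hn' : (0 : ℝ) < n := by exact_mod_cast hn
  have hη : 0 < n * ν n := mul_pos hn' (Real.rpow_pos_of_pos hn' _)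
  have hηsq : 12 * (n : ℝ) / (n * ν n) ^ 2 = 12 * (n : ℝ) ^ (-(1 / 2) : ℝ) := by
    have h1 : (n : ℝ) ^ (-(1 / 2) : ℝ) * n * (ν n) ^ 2 = 1 := by
      rw [hν]
      dsimp only
      rw [← Real.rpow_natCast, ← Real.rpow_mul hn'.le, mul_right_comm, ← Real.rpow_add hn']
      norm_num
      rw [Real.rpow_neg_one]
      exact inv_mul_cancel₀ hn'.ne'
    rw [div_eq_iff (by positivity)]
    linear_combination (-12 * (n : ℝ)) * h1
  have b1 := card_deficient_le (n := n) orderInvariant_turnPattern (by norm_num)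
    (I := Finset.Ico 0 (n / 2 - 6)) (fun i hi => by rw [Finset.mem_Ico] at hi; omega)
    (by rw [Nat.card_Ico]; omega) hη
  have b2 := card_deficient_le (n := n) orderInvariant_turnPattern (by norm_num)
    (I := Finset.Ico (n / 2) (n - 6)) (fun i hi => by rw [Finset.mem_Ico] at hi; omega)
    (by rw [Nat.card_Ico]; omega) hη
  have b3 := card_deficient_le (n := n) orderInvariant_interiorTurnPattern (by norm_num)
    (I := Finset.Ico 0 (n / 2 - 6)) (fun i hi => by rw [Finset.mem_Ico] at hi; omega)
    (by rw [Nat.card_Ico]; omega) hη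
  have b4 := card_deficient_le (n := n) orderInvariant_interiorTurnPattern (by norm_num)
    (I := Finset.Ico (n / 2) (n - 6)) (fun i hi => by rw [Finset.mem_Ico] at hi; omega)
    (by rw [Nat.card_Ico]; omega) hη
  have b5 := card_deficient_le (n := n) orderInvariant_monotonePattern (by norm_num)
    (I := Finset.range (n - 4)) (fun i hi => by rw [Finset.mem_range] at hi; omega)
    (by rw [Finset.card_range]; omega) hη
  rw [hηsq] at b1 b2 b3 b4 b5
  set D1 := deficient TurnPattern n (Finset.Ico 0 (n / 2 - 6)) (n * ν n)
  set D2 := deficient TurnPattern n (Finset.Ico (n / 2) (n - 6)) (n * ν n)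
  set D3 := deficient InteriorTurnPattern n (Finset.Ico 0 (n / 2 - 6)) (n * ν n)
  set D4 := deficient InteriorTurnPattern n (Finset.Ico (n / 2) (n - 6)) (n * ν n)
  set D5 := deficient MonotonePattern n (Finset.range (n - 4)) (n * ν n)
  set s : Set (Equiv.Perm (Fin n)) := {π | ((1 : ℝ) / 3 + 1 / 60 + -(10 * (n : ℝ)⁻¹ + 2 * ν n)) *
    (n : ℝ) ≤ (Twins.alpha π : ℝ) ∧
      (Twins.alpha π : ℝ) ≤ ((1 : ℝ) / 2 - 1 / 120 + ((n : ℝ)⁻¹ + ν n / 2)) * (n : ℝ)}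
  have hsub : sᶜ ⊆ ((D1 ∪ (D2 ∪ (D3 ∪ (D4 ∪ D5))) : Finset (Equiv.Perm (Fin n))) : Set _) := by
    intro π hπ
    by_contra hcon
    simp only [Finset.mem_coe, Finset.mem_union, not_or] at hcon
    obtain ⟨k1, k2, k3, k4, k5⟩ := hcon
    obtain ⟨hl, hu⟩ := alpha_bounds k1 k2 k3 k4 k5
    have hcancel : (n : ℝ)⁻¹ * n = 1 := inv_mul_cancel₀ hn'.ne'
    refine hπ ⟨le_trans (le_of_eq ?_) hl, hu.trans (le_of_eq ?_)⟩
    · linear_combination (-10) * hcancel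
    · linear_combination -hcancel
  have hcard : Nat.card ↥sᶜ ≤ D1.card + (D2.card + (D3.card + (D4.card + D5.card))) := by
    refine (Nat.card_mono (Finset.finite_toSet _) hsub).trans ?_
    rw [Nat.card_coe_set_eq, Set.ncard_coe_finset]
    refine (Finset.card_union_le _ _).trans (Nat.add_le_add_left ?_ _)
    refine (Finset.card_union_le _ _).trans (Nat.add_le_add_left ?_ _)
    refine (Finset.card_union_le _ _).trans (Nat.add_le_add_left ?_ _)
    exact Finset.card_union_le _ _
  have hcard' : (Nat.card ↥sᶜ : ℝ) ≤
      D1.card + (D2.card + (D3.card + (D4.card + D5.card))) := by exact_mod_cast hcard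
  refine hcard'.trans ?_
  linarith
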